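/- Let $n$ be a natural number, let $V\subseteq\mathbb{C}^n$ be an algebraic variety, that is, the set of common zeroes of a finite list of complex polynomials in $n$ variables ($V$ need not be irreducible), and let $\mathbb{S}_1^n=\{z\in\mathbb{C}^n : |z_1|=\dots=|z_n|=1\}$. The complex dimension of $V$ is the largest $d$ for which the projection of $V$ to some $d$ of the $n$ complex coordinates contains a non-empty open subset of $\mathbb{C}^d$; the real dimension of a subset $A\subseteq\mathbb{C}^n=\mathbb{R}^{2n}$ is the largest $d$ for which the projection of $A$ to some $d$ of the $2n$ real coordinates (the real and imaginary parts) contains a non-empty open subset of $\mathbb{R}^d$; the empty set has dimension $-\infty$ in both senses. If $V\cap\mathbb{S}_1^n$ is Zariski dense in $V$, i.e. every polynomial vanishing on $V\cap\mathbb{S}_1^n$ vanishes on $V$, then $$\dim_{\mathbb{R}}(V\cap\mathbb{S}_1^n)=\dim_{\mathbb{C}}V .$$ This is the largest possible value: $\dim_{\mathbb{R}}(V\cap\mathbb{S}_1^n)\le\dim_{\mathbb{C}}V$ for every algebraic variety $V\subseteq\mathbb{C}^n$. Hence the intersection is either not Zariski dense in $V$ or of the highest possible dimension. -/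

import Mathlib

/-- A set `V ⊆ ℂⁿ` is an algebraic variety (a Zariski closed set) if it is the set of common
zeroes of finitely many complex polynomials in `n` variables. It need not be irreducible. -/
def IsAlgebraicVariety {n : ℕ} (V : Set (Fin n → ℂ)) : Prop :=
  ∃ S : Finset (MvPolynomial (Fin n) ℂ), V = {z | ∀ p ∈ S, MvPolynomial.eval z p = 0}

/-- `U` is a Zariski dense subset of `V`: it is contained in `V`, and every polynomial that
vanishes at each point of `U` vanishes at each point of `V`. -/
def IsZariskiDenseIn {n : ℕ} (U V : Set (Fin n → ℂ)) : Prop :=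
  U ⊆ V ∧ ∀ p : MvPolynomial (Fin n) ℂ,
    (∀ z ∈ U, MvPolynomial.eval z p = 0) → ∀ z ∈ V, MvPolynomial.eval z p = 0

/-- The torus `𝕊₁ⁿ ⊆ ℂⁿ`: the points all of whose coordinates have absolute value `1`. -/
def unitTorus (n : ℕ) : Set (Fin n → ℂ) :=
  {z | ∀ i, ‖z i‖ = 1}

/-- The projection of `A ⊆ 𝕜^ι` to the `d` distinct coordinates `k 0, …, k (d - 1)` contains a
non-empty open subset of `𝕜^d`. -/
def ProjectionContainsOpen {𝕜 ι : Type*} [TopologicalSpace 𝕜] (A : Set (ι → 𝕜)) {d : ℕ}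
    (k : Fin d ↪ ι) : Prop :=
  ∃ U : Set (Fin d → 𝕜), IsOpen U ∧ U.Nonempty ∧ U ⊆ (fun z i => z (k i)) '' A

/-- The largest `d` for which the projection of `A ⊆ 𝕜^ι` to some `d` coordinates contains a
non-empty open subset of `𝕜^d`. Such `d` are bounded by the number of coordinates, and `d = 0`
is one of them when `A` is non-empty; the dimension of the empty set is `⊥`. -/
noncomputable def projectionDim {𝕜 ι : Type*} [TopologicalSpace 𝕜] (A : Set (ι → 𝕜)) :
    WithBot ℕ∞ :=
  ⨆ (d : ℕ) (_ : ∃ k : Fin d ↪ ι, ProjectionContainsOpen A k), ((d : ℕ∞) : WithBot ℕ∞)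

/-- The complex dimension of a subset of `ℂⁿ`, through projections to complex coordinates. -/
noncomputable def complexDim {n : ℕ} (V : Set (Fin n → ℂ)) : WithBot ℕ∞ :=
  projectionDim V

/-- The identification of `ℂⁿ` with `ℝ²ⁿ` by real and imaginary parts. -/
def toRealCoords {n : ℕ} (z : Fin n → ℂ) : Fin n ⊕ Fin n → ℝ :=
  Sum.elim (fun i => (z i).re) (fun i => (z i).im)

/-- The real dimension of a subset of `ℂⁿ`, regarded as a subset of `ℝ²ⁿ`, through projections
to real coordinates. -/
noncomputable def realDim {n : ℕ} (A : Set (Fin n → ℂ)) : WithBot ℕ∞ :=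
  projectionDim (toRealCoords '' A)

/-! Write `T` for the torus. It is the fixed set of the antiholomorphic reflection `σ(z) = 1 / conj
z` where all coordinates are non-zero. For `Y ⊆ T` with Zariski closure `Z`, conjugating a
polynomial composed with `σ` and clearing denominators gives a polynomial, so `σ` preserves `Z` off
the coordinate hyperplanes (`torusReflection_mem_zariskiClosure`).

Suppose no non-zero polynomial in `d` coordinates vanishes on `Y`. Some component of `Z` then has a
transcendence basis of `m ≥ d` coordinates `l`, and near a generic `a ∈ Y` it is a continuous graph
`z = Ψ (z ∘ l)` (`exists_local_graph`). If `x ∈ T` is close to `a ∘ l`, then `Ψ x` and `σ (Ψ x)` are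
points of this graph over the same `x`. They coincide, so `Ψ x ∈ T`. Hence `Z` projects onto an open
set and `Z ∩ T` onto an open piece of an `m`-dimensional torus (`exists_free_coordinates`).

Both inequalities apply this to `Y = V ∩ T`, whose closure lies in `V`. Independence of the
coordinates comes from a real projection containing an open set for `≤`, and from Zariski density
for `≥`. -/

/-! ### Étale coordinates at the generic point -/

/-- An algebraic extension of domains of characteristic zero is étale at the generic point. -/
theorem isEtaleAt_bot_of_isAlgebraic (R A : Type*) [CommRing R] [IsDomain R] [CharZero R]
    [CommRing A] [IsDomain A] [Algebra R A] [FaithfulSMul R A] [Algebra.IsAlgebraic R A] :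
    Algebra.IsEtaleAt R (⊥ : Ideal A) := by
  let K := FractionRing R
  let L := FractionRing A
  let _ : Algebra K L := FractionRing.liftAlgebra R L
  have : Algebra.IsAlgebraic K L := inferInstance
  have : CharZero K := inferInstance
  -- Characteristic zero enters here: the algebraic extension of fraction fields is separable.
  have : Algebra.FormallyEtale K L := Algebra.FormallyEtale.of_isSeparable K L
  have : Algebra.FormallyEtale R K :=
    Algebra.FormallyEtale.of_isLocalization (nonZeroDivisors R)
  have : Algebra.FormallyEtale R L := Algebra.FormallyEtale.comp R K L
  have : IsLocalization (nonZeroDivisors A) (Localization.AtPrime (⊥ : Ideal A)) := by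
    simpa [Ideal.primeCompl_bot] using
      Localization.isLocalization (M := (⊥ : Ideal A).primeCompl)
  exact Algebra.FormallyEtale.of_equiv
    ((IsLocalization.algEquiv (nonZeroDivisors A) L
      (Localization.AtPrime (⊥ : Ideal A))).restrictScalars R)

theorem isAlgebraic_aeval_of_isTranscendenceBasis {F A ι : Type*} [Field F] [CommRing A]
    [Algebra F A] {x : ι → A} (hx : IsTranscendenceBasis F x) :
    let _ : Algebra (MvPolynomial ι F) A := (MvPolynomial.aeval x).toRingHom.toAlgebra
    Algebra.IsAlgebraic (MvPolynomial ι F) A := by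
  let _ : Algebra (MvPolynomial ι F) A := (MvPolynomial.aeval x).toRingHom.toAlgebra
  have := hx.isAlgebraic
  refine ⟨fun a => ?_⟩
  have h := Algebra.IsAlgebraic.isAlgebraic (R := Algebra.adjoin F (Set.range x)) a
  exact h.of_ringHom_of_comp_eq
    (hx.1.aevalEquiv : MvPolynomial ι F →+* Algebra.adjoin F (Set.range x)) (RingHom.id A)
    hx.1.aevalEquiv.surjective Function.injective_id (by
      exact RingHom.ext fun p => by simp [RingHom.algebraMap_toAlgebra])

open MvPolynomial in
/-- Over the complement of a hypersurface, an irreducible variety is a simple branch of a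
one-variable polynomial equation over the coordinates of a transcendence basis. -/
theorem exists_standardEtale_coordinates {n d : ℕ} (P : Ideal (MvPolynomial (Fin n) ℂ))
    [P.IsPrime] (k : Fin d → Fin n)
    (hk : IsTranscendenceBasis ℂ (fun i => Ideal.Quotient.mk P (X (k i)))) :
    ∃ (g c : MvPolynomial (Fin n) ℂ) (N : ℕ) (F G : Polynomial (MvPolynomial (Fin d) ℂ))
      (p : Fin n → Polynomial (MvPolynomial (Fin d) ℂ)) (e : Fin n → ℕ), g ∉ P ∧
      (∀ z : Fin n → ℂ, (∀ f ∈ P, eval z f = 0) → eval z g ≠ 0 →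
        F.eval₂ (eval (z ∘ k)) (eval z c / eval z g ^ N) = 0 ∧
        G.eval₂ (eval (z ∘ k)) (eval z c / eval z g ^ N) ≠ 0 ∧
        F.derivative.eval₂ (eval (z ∘ k)) (eval z c / eval z g ^ N) ≠ 0 ∧
        ∀ j, z j * G.eval₂ (eval (z ∘ k)) (eval z c / eval z g ^ N) ^ e j =
          (p j).eval₂ (eval (z ∘ k)) (eval z c / eval z g ^ N)) ∧
      (∀ (x : Fin d → ℂ) (t : ℂ), F.eval₂ (eval x) t = 0 → G.eval₂ (eval x) t ≠ 0 →
        ∃ z : Fin n → ℂ, (∀ f ∈ P, eval z f = 0) ∧ z ∘ k = x ∧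
          ∀ j, z j * G.eval₂ (eval x) t ^ e j = (p j).eval₂ (eval x) t) := by
  let A := MvPolynomial (Fin n) ℂ ⧸ P
  let R := MvPolynomial (Fin d) ℂ
  let v : Fin d → A := fun i => Ideal.Quotient.mk P (X (k i))
  let _ : Algebra R A := (aeval v : R →ₐ[ℂ] A).toRingHom.toAlgebra
  have hC : ∀ r, algebraMap R A (C r) = Ideal.Quotient.mk P (C r) := fun r => (aeval v).commutes r
  have hX : ∀ i, algebraMap R A (X i) = Ideal.Quotient.mk P (X (k i)) := fun i => aeval_X v i
  have : Algebra.IsAlgebraic R A := isAlgebraic_aeval_of_isTranscendenceBasis hk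
  have : FaithfulSMul R A := (faithfulSMul_iff_algebraMap_injective R A).2 hk.1
  have : Algebra.IsEtaleAt R (⊥ : Ideal A) := isEtaleAt_bot_of_isAlgebraic R A
  have : IsScalarTower ℂ R A := IsScalarTower.of_algebraMap_eq fun c => by
    exact ((aeval v).commutes c).symm
  have : Algebra.FiniteType R A := Algebra.FiniteType.of_restrictScalars_finiteType ℂ R A
  have : Algebra.FinitePresentation R A := Algebra.FinitePresentation.of_finiteType.1 this
  obtain ⟨f, hf, ⟨⟨Q⟩⟩⟩ := Algebra.IsEtaleAt.exists_isStandardEtale (R := R) (⊥ : Ideal A)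
  obtain ⟨g, rfl⟩ := Ideal.Quotient.mk_surjective f
  let f : A := Ideal.Quotient.mk P g
  let S := Localization.Away f
  obtain ⟨N, c', hc⟩ := IsLocalization.Away.surj f (S := S) Q.x
  obtain ⟨c, rfl⟩ := Ideal.Quotient.mk_surjective c'
  -- A standard étale algebra is `R[t] / (F)` with `G` inverted, so each coordinate is a polynomial
  -- in `t` over a power of `G`.
  have hp : ∀ j, ∃ p : Polynomial R, ∃ e : ℕ,
      algebraMap A S (Ideal.Quotient.mk P (X j)) * (Q.g.aeval Q.x) ^ e = p.aeval Q.x :=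
    fun j => Q.exists_mul_aeval_x_g_pow_eq_aeval_x _
  choose p e hpe using hp
  have hcomp : ∀ φ : S →+* ℂ, ∀ x : Fin d → ℂ, φ.comp (algebraMap R S) = eval x →
      ∀ q : Polynomial R, φ (q.aeval Q.x) = q.eval₂ (eval x) (φ Q.x) := by
    intro φ x h q
    rw [Polynomial.aeval_def, Polynomial.hom_eval₂, h]
  refine ⟨g, c, N, Q.f, Q.g, p, e, fun h => hf ?_, ?_, ?_⟩
  · simpa using Ideal.Quotient.eq_zero_iff_mem.2 h
  · intro z hz hg
    let φA : A →+* ℂ := Ideal.Quotient.lift P (eval z) hz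
    have hφA : ∀ q, φA (Ideal.Quotient.mk P q) = eval z q := fun q => Ideal.Quotient.lift_mk ..
    have hu : IsUnit (φA f) := by rw [hφA]; exact hg.isUnit
    let φ : S →+* ℂ := IsLocalization.Away.lift f hu
    have hφ : ∀ a, φ (algebraMap A S a) = φA a := fun a => IsLocalization.Away.lift_eq f hu a
    have hx : φ.comp (algebraMap R S) = eval (z ∘ k) := by
      apply MvPolynomial.ringHom_ext
      · intro r
        rw [RingHom.comp_apply, IsScalarTower.algebraMap_apply R A S, hφ, hC, hφA]; simp
      · intro i
        rw [RingHom.comp_apply, IsScalarTower.algebraMap_apply R A S, hφ, hX, hφA]; simp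
    have ht : φ Q.x = eval z c / eval z g ^ N := by
      have := congrArg φ hc
      rw [map_mul, map_pow, hφ, hφ, hφA, hφA] at this
      rw [eq_div_iff (pow_ne_zero _ hg), this]
    have hq := hcomp φ _ hx
    rw [ht] at hq
    refine ⟨?_, ?_, ?_, fun j => ?_⟩
    · rw [← hq, Q.hasMap.1, map_zero]
    · rw [← hq]; exact (Q.hasMap.2.map φ).ne_zero
    · rw [← hq]; exact (Q.hasMap.isUnit_derivative_f.map φ).ne_zero
    · rw [← hq, ← hq, ← hpe, map_mul, map_pow, hφ, hφA, eval_X]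
  · intro x t hF hG
    let _ : Algebra R ℂ := (eval x).toAlgebra
    have hmap : Q.P.HasMap t := ⟨hF, (show Q.g.eval₂ (eval x) t ≠ 0 from hG).isUnit⟩
    -- A root `t` over `x` with `G ≠ 0` is a homomorphism from `S` to `ℂ`; the images of the
    -- coordinate functions form the point sought.
    let φ : S →ₐ[R] ℂ := (Q.P.lift t hmap).comp Q.equivRing.toAlgHom
    have hφx : φ Q.x = t := by simp [φ]
    have hφR : φ.toRingHom.comp (algebraMap R S) = eval x := φ.comp_algebraMap
    let z : Fin n → ℂ := fun j => φ (algebraMap A S (Ideal.Quotient.mk P (X j)))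
    have hφz : ∀ q, φ (algebraMap A S (Ideal.Quotient.mk P q)) = eval z q := by
      intro q
      have : (φ.toRingHom.comp (algebraMap A S)).comp (Ideal.Quotient.mk P) = eval z := by
        apply MvPolynomial.ringHom_ext
        · intro r
          have h2 : φ (algebraMap R S (C r)) = eval x (C r) := φ.commutes _
          rw [RingHom.comp_apply, ← hC, RingHom.comp_apply, ← IsScalarTower.algebraMap_apply]
          simpa using! h2
        · intro j; simp [z]
      exact congr($this q)
    have hq := hcomp φ.toRingHom _ hφR
    refine ⟨z, fun q hq => ?_, ?_, fun j => ?_⟩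
    · rw [← hφz, Ideal.Quotient.eq_zero_iff_mem.2 hq]; simp
    · funext i
      have h2 : φ (algebraMap R S (X i)) = eval x (X i) := φ.commutes _
      rw [Function.comp_apply]
      simp only [z]
      rw [← hX, ← IsScalarTower.algebraMap_apply, h2, eval_X]
    · have h1 := congrArg φ (hpe j)
      rw [map_mul, map_pow] at h1
      have h2 : ∀ q : Polynomial R, φ (q.aeval Q.x) = q.eval₂ (eval x) t := fun q => by
        have := hq q
        rw [← hφx]; exact this
      rw [h2, h2] at h1
      exact h1

/-! ### Implicit functions and local graphs -/

theorem MvPolynomial.contDiff_eval {ι : Type*} [Fintype ι] (p : MvPolynomial ι ℂ) :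
    ContDiff ℂ 1 (fun x : ι → ℂ => MvPolynomial.eval x p) := by
  induction p using MvPolynomial.induction_on with
  | C a => simpa using contDiff_const
  | add p q hp hq => simpa using hp.add hq
  | mul_X p i hp => simpa using hp.mul (contDiff_apply ℂ ℂ i)

theorem Polynomial.contDiff_eval₂_eval {ι : Type*} [Fintype ι]
    (F : Polynomial (MvPolynomial ι ℂ)) :
    ContDiff ℂ 1 (fun u : (ι → ℂ) × ℂ => F.eval₂ (MvPolynomial.eval u.1) u.2) := by
  simp only [Polynomial.eval₂_eq_sum_range]
  exact ContDiff.sum fun i _ =>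
    ((MvPolynomial.contDiff_eval _).comp contDiff_fst).mul (contDiff_snd.pow i)

/-- The partial derivative in the last variable is multiplication by the value of `F.derivative`, a
non-zero number. -/
theorem Polynomial.isInvertible_fderiv_comp_inr {ι : Type*} [Fintype ι]
    (F : Polynomial (MvPolynomial ι ℂ)) (u : (ι → ℂ) × ℂ)
    (hu : F.derivative.eval₂ (MvPolynomial.eval u.1) u.2 ≠ 0) :
    (fderiv ℂ (fun u : (ι → ℂ) × ℂ => F.eval₂ (MvPolynomial.eval u.1) u.2) u ∘L
      .inr ℂ (ι → ℂ) ℂ).IsInvertible := by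
  set f : (ι → ℂ) × ℂ → ℂ := fun u => F.eval₂ (MvPolynomial.eval u.1) u.2 with hf
  have h1 : HasFDerivAt f (fderiv ℂ f u) u :=
    ((Polynomial.contDiff_eval₂_eval F).differentiable one_ne_zero u).hasFDerivAt
  have h2 : HasDerivAt (fun t : ℂ => (u.1, t)) ((0 : ι → ℂ), (1 : ℂ)) u.2 :=
    (hasDerivAt_const _ _).prodMk (hasDerivAt_id _)
  have h3 : HasDerivAt (fun t => f (u.1, t)) (fderiv ℂ f u (0, 1)) u.2 :=
    HasFDerivAt.comp_hasDerivAt (l := f) (f := fun t : ℂ => (u.1, t)) u.2 h1 h2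
  have h4 : HasDerivAt (fun t => f (u.1, t))
      (F.derivative.eval₂ (MvPolynomial.eval u.1) u.2) u.2 := by
    simpa [hf, Polynomial.eval_map, Polynomial.derivative_map] using
      (F.map (MvPolynomial.eval u.1)).hasDerivAt u.2
  have h5 := h3.unique h4
  refine ⟨ContinuousLinearEquiv.unitsEquivAut ℂ (Units.mk0 _ hu), ?_⟩
  ext
  simp [h5]

open Filter Topology in
/-- Implicit function theorem for a simple root of a one-variable polynomial whose coefficients
are polynomials in parameters. -/
theorem Polynomial.exists_implicit_root {ι : Type*} [Fintype ι]
    (F : Polynomial (MvPolynomial ι ℂ)) (x₀ : ι → ℂ) (t₀ : ℂ)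
    (h0 : F.eval₂ (MvPolynomial.eval x₀) t₀ = 0)
    (h1 : F.derivative.eval₂ (MvPolynomial.eval x₀) t₀ ≠ 0) :
    ∃ ψ : (ι → ℂ) → ℂ, ContinuousAt ψ x₀ ∧ ψ x₀ = t₀ ∧
      (∀ᶠ x in 𝓝 x₀, F.eval₂ (MvPolynomial.eval x) (ψ x) = 0) ∧
      ∀ᶠ v in 𝓝 (x₀, t₀), F.eval₂ (MvPolynomial.eval v.1) v.2 = 0 → ψ v.1 = v.2 := by
  have cdf := (Polynomial.contDiff_eval₂_eval F).contDiffAt (x := (x₀, t₀))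
  have hinv := Polynomial.isInvertible_fderiv_comp_inr F (x₀, t₀) h1
  refine ⟨cdf.implicitFunction one_ne_zero hinv,
    (cdf.contDiffAt_implicitFunction one_ne_zero hinv).continuousAt,
    cdf.implicitFunction_apply_self one_ne_zero hinv, ?_, ?_⟩
  · filter_upwards [cdf.eventually_apply_implicitFunction one_ne_zero hinv] with x hx
    exact hx.trans h0
  · filter_upwards [cdf.eventually_apply_eq_iff_implicitFunction one_ne_zero hinv] with v hv hv0
    exact hv.1 (hv0.trans h0.symm)

open MvPolynomial Filter Topology in
/-- Near a generic point, an irreducible variety is the graph of a continuous function of the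
coordinates of a transcendence basis. -/
theorem exists_local_graph {n d : ℕ} (P : Ideal (MvPolynomial (Fin n) ℂ))
    [P.IsPrime] (k : Fin d → Fin n)
    (hk : IsTranscendenceBasis ℂ (fun i => Ideal.Quotient.mk P (X (k i)))) :
    ∃ g ∉ P, ∀ a : Fin n → ℂ, (∀ f ∈ P, eval a f = 0) → eval a g ≠ 0 →
      ∃ Ψ : (Fin d → ℂ) → (Fin n → ℂ), ContinuousAt Ψ (a ∘ k) ∧ Ψ (a ∘ k) = a ∧
        (∀ᶠ x in 𝓝 (a ∘ k), (∀ f ∈ P, eval (Ψ x) f = 0) ∧ Ψ x ∘ k = x) ∧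
        ∀ᶠ z in 𝓝 a, (∀ f ∈ P, eval z f = 0) → z = Ψ (z ∘ k) := by
  obtain ⟨g, c, N, F, G, p, e, hg, H1, H2⟩ := exists_standardEtale_coordinates P k hk
  refine ⟨g, hg, fun a ha hga => ?_⟩
  let τ : (Fin n → ℂ) → ℂ := fun z => eval z c / eval z g ^ N
  obtain ⟨hF, hG, hF', hz⟩ := H1 a ha hga
  have hcont : ∀ q : Polynomial (MvPolynomial (Fin d) ℂ),
      Continuous fun u : (Fin d → ℂ) × ℂ => q.eval₂ (eval u.1) u.2 :=
    fun q => (Polynomial.contDiff_eval₂_eval q).continuous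
  obtain ⟨ψ, hψc, hψ0, hψ1, hψ2⟩ := F.exists_implicit_root (a ∘ k) (τ a) hF hF'
  have hpair : ContinuousAt (fun x => (x, ψ x)) (a ∘ k) := continuousAt_id.prodMk hψc
  have hqψ : ∀ q : Polynomial (MvPolynomial (Fin d) ℂ),
      ContinuousAt (fun x => q.eval₂ (eval x) (ψ x)) (a ∘ k) := fun q =>
    ContinuousAt.comp (g := fun u : (Fin d → ℂ) × ℂ => q.eval₂ (eval u.1) u.2)
      (f := fun x => (x, ψ x)) (hcont q).continuousAt hpair
  have hG0 : G.eval₂ (eval (a ∘ k)) (ψ (a ∘ k)) ≠ 0 := by rw [hψ0]; exact hG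
  refine ⟨fun x j => (p j).eval₂ (eval x) (ψ x) / G.eval₂ (eval x) (ψ x) ^ e j, ?_, ?_, ?_, ?_⟩
  · refine continuousAt_pi.2 fun j => ?_
    exact (hqψ (p j)).div ((hqψ G).pow _) (pow_ne_zero _ hG0)
  · funext j
    rw [div_eq_iff (pow_ne_zero _ hG0), hψ0]
    exact (hz j).symm
  · filter_upwards [hψ1, (hqψ G).eventually_ne hG0] with x hx hGx
    obtain ⟨z, hzP, hzk, hzj⟩ := H2 x (ψ x) hx hGx
    have : (fun j => (p j).eval₂ (eval x) (ψ x) / G.eval₂ (eval x) (ψ x) ^ e j) = z := by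
      funext j
      rw [div_eq_iff (pow_ne_zero _ hGx), hzj]
    rw [this]
    exact ⟨hzP, hzk⟩
  · have hgc : ContinuousAt (fun z : Fin n → ℂ => eval z g) a :=
      (contDiff_eval g).continuous.continuousAt
    have hτ : ContinuousAt (fun z : Fin n → ℂ => (z ∘ k, τ z)) a := by
      refine ContinuousAt.prodMk ?_ ?_
      · exact continuousAt_pi.2 fun i => continuousAt_apply _ _
      · exact (contDiff_eval c).continuous.continuousAt.div (hgc.pow N) (pow_ne_zero _ hga)
    filter_upwards [hgc.eventually_ne hga, hτ.eventually hψ2] with z hgz hz2 hzP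
    obtain ⟨hFz, hGz, -, hzj⟩ := H1 z hzP hgz
    have h := hz2 hFz
    funext j
    rw [h, eq_div_iff (pow_ne_zero _ hGz)]
    exact hzj j

/-! ### Components and transcendence bases -/

/-- Algebraically independent members of a finite generating family extend to a transcendence
basis inside the family. -/
theorem exists_isTranscendenceBasis_extending {F A : Type*} [Field F] [CommRing A] [IsDomain A]
    [Algebra F A] {n d : ℕ} (v : Fin n → A) (hv : Algebra.adjoin F (Set.range v) = ⊤)
    (k : Fin d → Fin n) (hk : AlgebraicIndependent F (v ∘ k)) :
    ∃ (m : ℕ) (l : Fin m ↪ Fin n), d ≤ m ∧ IsTranscendenceBasis F (v ∘ l) := by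
  have halg : Algebra.IsAlgebraic (Algebra.adjoin F (Set.range v)) A := by
    rw [hv]
    exact ⟨fun a => isAlgebraic_algebraMap (⟨a, trivial⟩ : (⊤ : Subalgebra F A))⟩
  obtain ⟨u, hsu, hut, hu⟩ := exists_isTranscendenceBasis_between (R := F)
    (Set.range (v ∘ k)) (Set.range v) (Set.range_comp_subset_range k v) hk.to_subtype_range
  have hfin : Finite u := (Set.finite_range v).subset hut
  let e := Finite.equivFin u
  have hl : ∀ i : Fin (Nat.card u), ∃ j, v j = (e.symm i : A) := fun i => hut (e.symm i).2
  choose l hl using hl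
  have hvl : v ∘ l = Subtype.val ∘ e.symm := funext hl
  have hinj : Function.Injective l := by
    have : Function.Injective (v ∘ l) := by
      rw [hvl]; exact Subtype.val_injective.comp e.symm.injective
    exact this.of_comp
  refine ⟨Nat.card u, ⟨l, hinj⟩, ?_, ?_⟩
  · have h1 := Nat.card_mono hfin hsu
    have h2 := Nat.card_range_of_injective hk.injective
    simp only [Nat.card_eq_fintype_card, Fintype.card_fin] at h2
    rw [← h2]
    exact h1
  · change IsTranscendenceBasis F (v ∘ l)
    rw [hvl]
    exact hu.comp_equiv e.symm

/-- A minimal prime over a radical ideal of a noetherian ring agrees with the ideal after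
inverting some element outside the prime. -/
theorem Ideal.exists_notMem_mul_mem_of_mem_minimalPrimes {R : Type*} [CommRing R]
    [IsNoetherianRing R] {J P : Ideal R} (hJ : J.IsRadical) (hP : P ∈ J.minimalPrimes) :
    ∃ h ∉ P, ∀ f ∈ P, h * f ∈ J := by
  classical
  have hfin := Ideal.finite_minimalPrimes_of_isNoetherianRing R J
  have hprime : P.IsPrime := hP.1.1
  -- The product of these elements lies in every other minimal prime but not in `P`; the value `1`
  -- for irrelevant `Q` is never used.
  have hex : ∀ Q : Ideal R, ∃ h, h ∉ P ∧ (Q ∈ J.minimalPrimes → Q ≠ P → h ∈ Q) := by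
    intro Q
    by_cases hQ : Q ∈ J.minimalPrimes ∧ Q ≠ P
    · have : ¬ Q ≤ P := fun hle => hQ.2 (le_antisymm hle (hP.2 hQ.1.1 hle))
      obtain ⟨h, hhQ, hhP⟩ := SetLike.not_le_iff_exists.1 this
      exact ⟨h, hhP, fun _ _ => hhQ⟩
    · exact ⟨1, (Ideal.ne_top_iff_one P).1 hprime.ne_top, fun h1 h2 => (hQ ⟨h1, h2⟩).elim⟩
  choose h hhP hhQ using hex
  refine ⟨∏ Q ∈ hfin.toFinset, h Q, ?_, fun f hf => ?_⟩
  · rw [hprime.prod_mem_iff]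
    rintro ⟨Q, -, hQ⟩
    exact hhP Q hQ
  · refine hJ ?_
    have key := Ideal.sInf_minimalPrimes (I := J)
    refine key ▸ Ideal.mem_sInf.2 fun {Q} hQ => ?_
    by_cases hQP : Q = P
    · exact hQP ▸ Ideal.mul_mem_left _ _ hf
    · exact Ideal.mul_mem_right _ _
        (Q.mem_of_dvd (Finset.dvd_prod_of_mem h (hfin.mem_toFinset.2 hQ)) (hhQ Q hQ hQP))

open MvPolynomial in
/-- If no non-zero polynomial in the coordinates `k` vanishes on `X`, then some irreducible
component of the Zariski closure of `X` has a transcendence basis of at least as many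
coordinates. -/
theorem exists_component_isTranscendenceBasis {n d : ℕ} (Y : Set (Fin n → ℂ))
    (k : Fin d ↪ Fin n)
    (hX : ∀ p : MvPolynomial (Fin d) ℂ, (∀ z ∈ Y, eval (z ∘ k) p = 0) → p = 0) :
    ∃ (P : Ideal (MvPolynomial (Fin n) ℂ)) (_ : P.IsPrime) (m : ℕ) (l : Fin m ↪ Fin n),
      d ≤ m ∧ IsTranscendenceBasis ℂ (fun i => Ideal.Quotient.mk P (X (l i))) ∧
      (∀ f, (∀ z ∈ Y, eval z f = 0) → f ∈ P) ∧
      ∃ h ∉ P, ∀ f ∈ P, ∀ z ∈ Y, eval z h * eval z f = 0 := by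
  let J : Ideal (MvPolynomial (Fin n) ℂ) := vanishingIdeal ℂ Y
  have hJ : ∀ f, f ∈ J ↔ ∀ z ∈ Y, eval z f = 0 := fun f => by
    simp [J, mem_vanishingIdeal_iff, aeval_eq_eval]
  have hrad : J.IsRadical := by
    rintro f ⟨N, hN⟩
    rw [hJ] at hN ⊢
    exact fun z hz => by simpa using eq_zero_of_pow_eq_zero ((map_pow (eval z) f N) ▸ hN z hz)
  -- Since `J` contracts to zero, some minimal prime over `J` does too, and modulo that prime the
  -- coordinates `k` stay independent.
  have hcomap : J.comap (rename k : MvPolynomial (Fin d) ℂ →ₐ[ℂ] _).toRingHom = ⊥ := by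
    refine (Submodule.eq_bot_iff _).2 fun p hp => hX p fun z hz => ?_
    rw [← eval_rename]
    exact (hJ _).1 hp z hz
  obtain ⟨P, hP, hPk⟩ := Ideal.exists_minimalPrimes_comap_eq (I := J)
    (rename k : MvPolynomial (Fin d) ℂ →ₐ[ℂ] _).toRingHom ⊥ (by
      rw [hcomap, Ideal.minimalPrimes_eq_subsingleton_self]; rfl)
  have hprime : P.IsPrime := hP.1.1
  obtain ⟨h, hhP, hh⟩ := Ideal.exists_notMem_mul_mem_of_mem_minimalPrimes hrad hP
  let v : Fin n → MvPolynomial (Fin n) ℂ ⧸ P := fun j => Ideal.Quotient.mk P (X j)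
  have haev : ∀ q, aeval v q = Ideal.Quotient.mk P q := fun q => by
    have : aeval v = Ideal.Quotient.mkₐ ℂ P := MvPolynomial.algHom_ext fun i => by simp [v]
    rw [this]; rfl
  have hgen : Algebra.adjoin ℂ (Set.range v) = ⊤ := by
    rw [Algebra.adjoin_range_eq_range_aeval, AlgHom.range_eq_top]
    intro y
    obtain ⟨q, rfl⟩ := Ideal.Quotient.mk_surjective y
    exact ⟨q, haev q⟩
  have hind : AlgebraicIndependent ℂ (v ∘ k) := by
    rw [algebraicIndependent_iff]
    intro p hp
    rw [← aeval_rename, haev, Ideal.Quotient.eq_zero_iff_mem] at hp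
    have : p ∈ P.comap (rename k : MvPolynomial (Fin d) ℂ →ₐ[ℂ] _).toRingHom := hp
    rwa [hPk] at this
  obtain ⟨m, l, hdm, hl⟩ := exists_isTranscendenceBasis_extending v hgen k hind
  refine ⟨P, hprime, m, l, hdm, hl, fun f hf => hP.1.2 ((hJ f).2 hf), h, hhP, fun f hf z hz => ?_⟩
  simpa using (hJ _).1 (hh f hf) z hz

/-! ### Reflection in the torus -/

/-- The reflection of `ℂⁿ` in the unit torus. -/
noncomputable def torusReflection {n : ℕ} (z : Fin n → ℂ) : Fin n → ℂ :=
  fun i => (starRingEnd ℂ (z i))⁻¹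

theorem torusReflection_eq_self_iff {n : ℕ} {z : Fin n → ℂ} (hz : ∀ i, z i ≠ 0) :
    torusReflection z = z ↔ z ∈ unitTorus n := by
  simp only [unitTorus, Set.mem_ofPred_eq, funext_iff, torusReflection]
  refine forall_congr' fun i => ?_
  rw [inv_eq_iff_eq_inv, ← mul_eq_one_iff_eq_inv₀ (hz i), mul_comm, Complex.mul_conj,
    Complex.normSq_eq_norm_sq]
  norm_cast
  exact pow_eq_one_iff_of_nonneg (norm_nonneg _) two_ne_zero

theorem ne_zero_of_mem_unitTorus {n : ℕ} {z : Fin n → ℂ} (hz : z ∈ unitTorus n) (i : Fin n) :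
    z i ≠ 0 := by
  intro h
  simpa [h] using hz i

open MvPolynomial in
theorem MvPolynomial.exists_eval_torusReflection {n : ℕ} (f : MvPolynomial (Fin n) ℂ) :
    ∃ (f' : MvPolynomial (Fin n) ℂ) (N : ℕ), ∀ z : Fin n → ℂ, (∀ i, z i ≠ 0) →
      eval z f' = (∏ i, z i) ^ N * starRingEnd ℂ (eval (torusReflection z) f) := by
  induction f using MvPolynomial.induction_on with
  | C a => exact ⟨C (starRingEnd ℂ a), 0, fun z _ => by simp⟩
  | add p q hp hq =>
    obtain ⟨p', N, hp⟩ := hp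
    obtain ⟨q', M, hq⟩ := hq
    refine ⟨p' * (∏ i, X i) ^ M + q' * (∏ i, X i) ^ N, N + M, fun z hz => ?_⟩
    simp only [map_add, map_mul, map_pow, map_prod, eval_X, hp z hz, hq z hz]
    ring
  | mul_X p i hp =>
    obtain ⟨p', N, hp⟩ := hp
    -- The new factor is `1 / z i`; one more power of `∏ j, z j` turns it into the product over `j ≠
    -- i`.
    refine ⟨p' * ∏ j ∈ Finset.univ.erase i, X j, N + 1, fun z hz => ?_⟩
    have : ∏ j, z j = z i * ∏ j ∈ Finset.univ.erase i, z j :=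
      (Finset.mul_prod_erase _ _ (Finset.mem_univ i)).symm
    have h2 : starRingEnd ℂ (torusReflection z i) = (z i)⁻¹ := by simp [torusReflection]
    simp only [map_mul, map_prod, eval_X, hp z hz, h2, pow_succ]
    rw [this]
    field_simp [hz i]

/-- The Zariski closure of a set of points. -/
def zariskiClosure {n : ℕ} (Y : Set (Fin n → ℂ)) : Set (Fin n → ℂ) :=
  {z | ∀ f : MvPolynomial (Fin n) ℂ,
    (∀ w ∈ Y, MvPolynomial.eval w f = 0) → MvPolynomial.eval z f = 0}

/-- If `f` vanishes on `Y`, so does its reflected polynomial, because reflection fixes `Y`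
pointwise. -/
theorem torusReflection_mem_zariskiClosure {n : ℕ} {Y : Set (Fin n → ℂ)}
    (hX : Y ⊆ unitTorus n) {z : Fin n → ℂ} (hz : z ∈ zariskiClosure Y) (hz0 : ∀ i, z i ≠ 0) :
    torusReflection z ∈ zariskiClosure Y := by
  intro f hf
  obtain ⟨f', N, hf'⟩ := MvPolynomial.exists_eval_torusReflection f
  have h := hz f' fun w hw => by
    have hw0 := ne_zero_of_mem_unitTorus (hX hw)
    rw [hf' w hw0, (torusReflection_eq_self_iff hw0).2 (hX hw), hf w hw]
    simp
  rw [hf' z hz0] at h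
  have hp : (∏ i, z i) ^ N ≠ 0 := pow_ne_zero _ (Finset.prod_ne_zero_iff.2 fun i _ => hz0 i)
  simpa [hp] using h

open MvPolynomial Filter Topology in
/-- If no non-zero polynomial in `d` coordinates vanishes on a subset of the torus, then near some
point of the torus, at least `d` coordinates are free both on the Zariski closure of the set and
on the toric part of that closure. -/
theorem exists_free_coordinates {n d : ℕ} {Y : Set (Fin n → ℂ)} (hXT : Y ⊆ unitTorus n)
    (k : Fin d ↪ Fin n)
    (hX : ∀ p : MvPolynomial (Fin d) ℂ, (∀ z ∈ Y, eval (z ∘ k) p = 0) → p = 0) :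
    ∃ (m : ℕ) (l : Fin m ↪ Fin n) (x₀ : Fin m → ℂ), d ≤ m ∧ x₀ ∈ unitTorus m ∧
      (∀ᶠ x in 𝓝 x₀, ∃ z ∈ zariskiClosure Y, z ∘ l = x) ∧
      ∀ᶠ x in 𝓝 x₀, x ∈ unitTorus m → ∃ z ∈ zariskiClosure Y ∩ unitTorus n, z ∘ l = x := by
  obtain ⟨P, hprime, m, l, hdm, hl, hJP, h, hhP, hh⟩ :=
    exists_component_isTranscendenceBasis Y k hX
  obtain ⟨g, hgP, hg⟩ := exists_local_graph P l hl
  -- Otherwise `g * h` would vanish on `Y` and so lie in the prime `P`.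
  obtain ⟨a, haX, ha⟩ : ∃ a ∈ Y, eval a (g * h) ≠ 0 := by
    by_contra! hcon
    exact (hprime.mem_or_mem (hJP _ hcon)).elim hgP hhP
  rw [map_mul] at ha
  have hga := left_ne_zero_of_mul ha
  have hha := right_ne_zero_of_mul ha
  have haP : ∀ f ∈ P, eval a f = 0 := fun f hf =>
    (mul_eq_zero.1 (hh f hf a haX)).resolve_left hha
  obtain ⟨Ψ, hΨc, hΨa, hΨ1, hΨ2⟩ := hg a haP hga
  have hPZ : ∀ z : Fin n → ℂ, (∀ f ∈ P, eval z f = 0) → z ∈ zariskiClosure Y :=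
    fun z hz f hf => hz f (hJP f hf)
  have haT := hXT haX
  have ha0 := ne_zero_of_mem_unitTorus haT
  have hΨt : Tendsto Ψ (𝓝 (a ∘ l)) (𝓝 a) := by
    have := hΨc.tendsto
    rwa [hΨa] at this
  have hσ : Tendsto (torusReflection (n := n)) (𝓝 a) (𝓝 a) := by
    have : ContinuousAt (torusReflection (n := n)) a := continuousAt_pi.2 fun i =>
      (Complex.continuous_conj.comp (continuous_apply i)).continuousAt.inv₀ (by simpa using ha0 i)
    have h2 := this.tendsto
    rwa [(torusReflection_eq_self_iff ha0).2 haT] at h2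
  have hne : ∀ᶠ z in 𝓝 a, ∀ i, z i ≠ 0 :=
    eventually_all.2 fun i => (continuous_apply i).continuousAt.eventually_ne (ha0 i)
  have hhne : ∀ᶠ z in 𝓝 a, eval z h ≠ 0 :=
    (contDiff_eval h).continuous.continuousAt.eventually_ne hha
  refine ⟨m, l, a ∘ l, hdm, fun i => haT (l i), ?_, ?_⟩
  · filter_upwards [hΨ1] with x hx
    exact ⟨Ψ x, hPZ _ hx.1, hx.2⟩
  · filter_upwards [hΨ1, hΨt.eventually hne, (hσ.comp hΨt).eventually hhne,
      (hσ.comp hΨt).eventually hΨ2] with x hx hx0 hxh hxΨ hxT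
    have hZ := torusReflection_mem_zariskiClosure hXT (hPZ _ hx.1) hx0
    -- The reflected point might lie on another component of the closure; `h ≠ 0` near `a` excludes
    -- this.
    have hP : ∀ f ∈ P, eval (torusReflection (Ψ x)) f = 0 := fun f hf => by
      have := hZ (h * f) fun w hw => by rw [map_mul]; exact hh f hf w hw
      rw [map_mul] at this
      exact (mul_eq_zero.1 this).resolve_left hxh
    have hfix := hxΨ hP
    have hproj : torusReflection (Ψ x) ∘ l = x := by
      have h1 : torusReflection (Ψ x) ∘ l = torusReflection (Ψ x ∘ l) := rfl
      rw [h1, hx.2]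
      exact (torusReflection_eq_self_iff (ne_zero_of_mem_unitTorus hxT)).2 hxT
    simp only [Function.comp_apply] at hfix
    rw [hproj] at hfix
    exact ⟨Ψ x, ⟨hPZ _ hx.1, (torusReflection_eq_self_iff hx0).1 hfix⟩, hx.2⟩

/-! ### Real coordinates on the torus -/

/-- The real part (`b = true`) or the imaginary part (`b = false`) of a complex number. -/
def realCoord (b : Bool) (w : ℂ) : ℝ := if b then w.re else w.im

/-- The point of the unit circle with real or imaginary part `t` (according to `b`), on one of
the two half circles. -/
noncomputable def circleBranch (b s : Bool) (t : ℝ) : ℂ :=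
  let r : ℝ := if s then √(1 - t ^ 2) else -√(1 - t ^ 2)
  if b then ⟨t, r⟩ else ⟨r, t⟩

theorem realCoord_circleBranch (b s : Bool) (t : ℝ) :
    realCoord b (circleBranch b s t) = t := by
  cases b <;> simp [realCoord, circleBranch]

/-- This holds for all real `t`, even beyond `|t| = 1`, where the square root is `0` and the point
leaves the circle. -/
theorem circleBranch_injective (b s : Bool) : Function.Injective (circleBranch b s) :=
  Function.LeftInverse.injective (realCoord_circleBranch b s)

theorem continuous_circleBranch (b s : Bool) : Continuous (circleBranch b s) := by
  have h : Continuous fun t : ℝ => √(1 - t ^ 2) := by fun_prop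
  have key : ∀ f g : ℝ → ℝ, Continuous f → Continuous g →
      Continuous fun t => (⟨f t, g t⟩ : ℂ) := fun f g hf hg =>
    Complex.equivRealProdCLM.symm.continuous.comp (hf.prodMk hg)
  unfold circleBranch
  cases b <;> cases s <;> simp only [if_true, Bool.false_eq_true, if_false]
  exacts [key _ _ h.neg continuous_id, key _ _ h continuous_id, key _ _ continuous_id h.neg,
    key _ _ continuous_id h]

theorem norm_circleBranch (b s : Bool) {t : ℝ} (ht : t ^ 2 ≤ 1) : ‖circleBranch b s t‖ = 1 := by
  have h : √(1 - t ^ 2) * √(1 - t ^ 2) = 1 - t ^ 2 := Real.mul_self_sqrt (by linarith)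
  rw [Complex.norm_def, Real.sqrt_eq_one, Complex.normSq_apply]
  cases b <;> cases s <;> simp [circleBranch] <;> linarith

theorem re_sq_add_im_sq_of_norm_eq_one {w : ℂ} (hw : ‖w‖ = 1) : w.re ^ 2 + w.im ^ 2 = 1 := by
  have := Complex.sq_norm w
  rw [hw, Complex.normSq_apply] at this
  linarith

theorem exists_eq_circleBranch (b : Bool) {w : ℂ} (hw : ‖w‖ = 1) :
    ∃ s, w = circleBranch b s (realCoord b w) := by
  have h := re_sq_add_im_sq_of_norm_eq_one hw
  have key : ∀ x y : ℝ, x ^ 2 + y ^ 2 = 1 →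
      ∃ s : Bool, y = if s then √(1 - x ^ 2) else -√(1 - x ^ 2) := by
    intro x y hxy
    have : 1 - x ^ 2 = y ^ 2 := by linarith
    rw [this, Real.sqrt_sq_eq_abs]
    rcases abs_choice y with hy | hy
    · exact ⟨true, by simp [hy]⟩
    · exact ⟨false, by simp [hy]⟩
  cases b
  · obtain ⟨s, hs⟩ := key w.im w.re (by linarith)
    exact ⟨s, Complex.ext hs rfl⟩
  · obtain ⟨s, hs⟩ := key w.re w.im h
    exact ⟨s, Complex.ext rfl hs⟩

theorem exists_realCoord_sq_lt_one {w : ℂ} (hw : ‖w‖ = 1) : ∃ b, realCoord b w ^ 2 < 1 := by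
  have h := re_sq_add_im_sq_of_norm_eq_one hw
  by_cases hre : w.re ^ 2 < 1
  · exact ⟨true, hre⟩
  · exact ⟨false, show w.im ^ 2 < 1 by linarith⟩

theorem toRealCoords_apply {n : ℕ} (z : Fin n → ℂ) (j : Fin n ⊕ Fin n) :
    toRealCoords z j = realCoord j.isLeft (z (j.elim id id)) := by
  cases j <;> simp [toRealCoords, realCoord]

/-- An open set contains a box with infinite sides, and a polynomial vanishing on a product of
infinite sets is zero. -/
theorem MvPolynomial.eq_zero_of_eval_injective_eq_zero {𝕜 : Type*} [NontriviallyNormedField 𝕜]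
    {d : ℕ} {W : Set (Fin d → 𝕜)} (hW : IsOpen W) (hne : W.Nonempty) (c : Fin d → 𝕜 → ℂ)
    (hc : ∀ i, Function.Injective (c i)) (p : MvPolynomial (Fin d) ℂ)
    (hp : ∀ t ∈ W, MvPolynomial.eval (fun i => c i (t i)) p = 0) : p = 0 := by
  obtain ⟨a, ha⟩ := hne
  obtain ⟨u, hu, huW⟩ := isOpen_pi_iff'.1 hW a ha
  refine MvPolynomial.funext_set (fun i => c i '' u i) (fun i => ?_) fun x hx => ?_
  · exact ((infinite_of_mem_nhds (a i) ((hu i).1.mem_nhds (hu i).2)).image (hc i).injOn)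
  · choose t ht using fun i => hx i trivial
    have hxt : x = fun i => c i (t i) := by funext i; exact (ht i).2.symm
    rw [map_zero, hxt]
    exact hp t (huW fun i _ => (ht i).1)

theorem eq_zero_of_projectionContainsOpen {n d : ℕ} {V : Set (Fin n → ℂ)} {k : Fin d ↪ Fin n}
    (h : ProjectionContainsOpen V k) (p : MvPolynomial (Fin d) ℂ)
    (hp : ∀ z ∈ V, MvPolynomial.eval (z ∘ k) p = 0) : p = 0 := by
  obtain ⟨U, hU, hne, hUV⟩ := h
  refine MvPolynomial.eq_zero_of_eval_injective_eq_zero hU hne (fun _ => id)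
    (fun _ => Function.injective_id) p fun t ht => ?_
  obtain ⟨z, hz, rfl⟩ := hUV ht
  exact hp z hz

theorem injective_of_projectionContainsOpen {n d : ℕ} {A : Set (Fin n → ℂ)}
    (hA : A ⊆ unitTorus n) {κ : Fin d ↪ Fin n ⊕ Fin n}
    (h : ProjectionContainsOpen (toRealCoords '' A) κ) :
    Function.Injective fun i => (κ i).elim id id := by
  obtain ⟨U, hU, ⟨u, hu⟩, hUA⟩ := h
  intro i j hij
  by_contra hne
  -- Two real coordinates from one complex coordinate satisfy the circle equation, which cannot hold
  -- on an open set.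
  have hsum : ∀ t ∈ U, t i ^ 2 + t j ^ 2 = 1 := by
    intro t ht
    obtain ⟨_, ⟨z, hz, rfl⟩, rfl⟩ := hUA ht
    have hκ : κ i ≠ κ j := fun h => hne (κ.injective h)
    simp only at hij ⊢
    rcases hi : κ i with a | a <;> rcases hj : κ j with c | c <;> rw [hi, hj] at hij hκ <;>
      simp only [Sum.elim_inl, Sum.elim_inr, id] at hij <;> subst hij
    · exact (hκ rfl).elim
    · exact re_sq_add_im_sq_of_norm_eq_one (hA hz a)
    · exact (add_comm _ _).trans (re_sq_add_im_sq_of_norm_eq_one (hA hz a))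
    · exact (hκ rfl).elim
  obtain ⟨ε, hε, hball⟩ := Metric.isOpen_iff.1 hU u hu
  have hmove : ∀ s, 0 < s → s < ε → s * (2 * u i + s) = 0 := by
    intro s hs0 hs
    have hmem : Function.update u i (u i + s) ∈ U := hball (by
      rw [Metric.mem_ball, dist_pi_lt_iff hε]
      intro a
      by_cases ha : a = i
      · subst ha; simpa [abs_of_pos hs0] using hs
      · simpa [ha] using hε)
    have h1 := hsum _ hmem
    have h2 := hsum u hu
    rw [Function.update_self, Function.update_of_ne (Ne.symm hne)] at h1
    linarith
  have h1 := hmove (ε / 2) (by linarith) (by linarith)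
  have h2 := hmove (ε / 3) (by linarith) (by linarith)
  have h3 := (mul_eq_zero.1 h1).resolve_left (by linarith)
  have h4 := (mul_eq_zero.1 h2).resolve_left (by linarith)
  linarith

/-- A subset of the torus with a real projection containing an open set is not contained in a
hypersurface of the corresponding complex coordinates. -/
theorem eq_zero_of_projectionContainsOpen_toRealCoords {n d : ℕ} {A : Set (Fin n → ℂ)}
    (hA : A ⊆ unitTorus n) {κ : Fin d ↪ Fin n ⊕ Fin n}
    (h : ProjectionContainsOpen (toRealCoords '' A) κ) (p : MvPolynomial (Fin d) ℂ)
    (hp : ∀ z ∈ A, MvPolynomial.eval (fun i => z ((κ i).elim id id)) p = 0) : p = 0 := by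
  obtain ⟨U, hU, hne, hUA⟩ := h
  let E : (Fin d → Bool) → Set (Fin d → ℝ) := fun s =>
    {t | MvPolynomial.eval (fun i => circleBranch (κ i).isLeft (s i) (t i)) p = 0}
  have hE : ∀ s, IsClosed (E s) := fun s => by
    refine isClosed_eq ((MvPolynomial.contDiff_eval p).continuous.comp ?_) continuous_const
    exact continuous_pi fun i => (continuous_circleBranch _ _).comp (continuous_apply i)
  have hcover : ∀ t ∈ U, ∃ s, t ∈ E s := by
    intro t ht
    obtain ⟨_, ⟨z, hz, rfl⟩, rfl⟩ := hUA ht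
    choose s hs using fun i => exists_eq_circleBranch (κ i).isLeft (hA hz ((κ i).elim id id))
    refine ⟨s, ?_⟩
    have := hp z hz
    simp only [E, Set.mem_ofPred_eq, toRealCoords_apply, ← hs]
    exact this
  -- Baire: finitely many closed sets cover `U`, so one of them has interior.
  obtain ⟨s, hs⟩ : ∃ s, (interior (E s)).Nonempty := by
    by_contra! hcon
    have hdense : Dense (⋂ s, (E s)ᶜ) := dense_iInter_of_isOpen (fun s => (hE s).isOpen_compl)
      fun s => interior_eq_empty_iff_dense_compl.1 (hcon s)
    obtain ⟨t, ht, htU⟩ := hdense.inter_open_nonempty U hU hne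
    obtain ⟨s, hts⟩ := hcover t ht
    exact Set.mem_iInter.1 htU s hts
  exact MvPolynomial.eq_zero_of_eval_injective_eq_zero isOpen_interior hs
    (fun i => circleBranch (κ i).isLeft (s i)) (fun i => circleBranch_injective _ _) p
    fun t ht => show t ∈ E s from interior_subset ht

open Topology Filter in
/-- If the projection of a set to complex coordinates contains a neighbourhood of a point of the
torus inside the torus, then its projection to suitable real coordinates contains an open set. -/
theorem exists_projectionContainsOpen_toRealCoords {n m : ℕ} {A : Set (Fin n → ℂ)}
    (l : Fin m ↪ Fin n) {x₀ : Fin m → ℂ} (hx₀ : x₀ ∈ unitTorus m)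
    (h : ∀ᶠ x in 𝓝 x₀, x ∈ unitTorus m → ∃ z ∈ A, z ∘ l = x) :
    ∃ κ : Fin m ↪ Fin n ⊕ Fin n, ProjectionContainsOpen (toRealCoords '' A) κ := by
  -- In each factor, the real or imaginary part is a local coordinate of the circle wherever its
  -- square is less than `1`.
  choose b hb using fun i => exists_realCoord_sq_lt_one (hx₀ i)
  choose s hs using fun i => exists_eq_circleBranch (b i) (hx₀ i)
  let κ₀ : Fin m → Fin n ⊕ Fin n := fun i => if b i then Sum.inl (l i) else Sum.inr (l i)
  have hκl : ∀ i, (κ₀ i).elim id id = l i := fun i => by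
    simp only [κ₀]; cases b i <;> simp
  have hκb : ∀ i, (κ₀ i).isLeft = b i := fun i => by
    simp only [κ₀]; cases b i <;> simp
  have hinj : Function.Injective κ₀ := fun i j hij => l.injective (by rw [← hκl, hij, hκl])
  obtain ⟨M, hM, hMo, hxM⟩ := eventually_nhds_iff.1 h
  let β : (Fin m → ℝ) → Fin m → ℂ := fun t i => circleBranch (b i) (s i) (t i)
  have hβ : Continuous β :=
    continuous_pi fun i => (continuous_circleBranch _ _).comp (continuous_apply i)
  refine ⟨⟨κ₀, hinj⟩, β ⁻¹' M ∩ ⋂ i, {t | t i ^ 2 < 1}, ?_, ?_, ?_⟩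
  · refine (hMo.preimage hβ).inter (isOpen_iInter_of_finite fun i => ?_)
    exact isOpen_lt ((continuous_apply i).pow 2) continuous_const
  · refine ⟨fun i => realCoord (b i) (x₀ i), ?_, Set.mem_iInter.2 hb⟩
    have : β (fun i => realCoord (b i) (x₀ i)) = x₀ := funext fun i => (hs i).symm
    rw [Set.mem_preimage, this]
    exact hxM
  · rintro t ⟨htM, ht⟩
    obtain ⟨z, hz, hzx⟩ := hM _ htM fun i => norm_circleBranch _ _ (Set.mem_iInter.1 ht i).le
    refine ⟨toRealCoords z, ⟨z, hz, rfl⟩, funext fun i => ?_⟩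
    change toRealCoords z (κ₀ i) = t i
    rw [toRealCoords_apply, hκl, hκb]
    have : z (l i) = β t i := congrFun hzx i
    rw [this]
    exact realCoord_circleBranch _ _ _

/-! ### Comparison of dimensions -/

/-- The number of coordinates may grow, since completing to a transcendence basis can add some. -/
theorem projectionDim_le_projectionDim {𝕜 ι 𝕜' ι' : Type*} [TopologicalSpace 𝕜]
    [TopologicalSpace 𝕜'] {A : Set (ι → 𝕜)} {B : Set (ι' → 𝕜')}
    (h : ∀ (d : ℕ) (k : Fin d ↪ ι), ProjectionContainsOpen A k →
      ∃ (m : ℕ) (l : Fin m ↪ ι'), d ≤ m ∧ ProjectionContainsOpen B l) :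
    projectionDim A ≤ projectionDim B := by
  refine iSup₂_le fun d ⟨k, hk⟩ => ?_
  obtain ⟨m, l, hdm, hl⟩ := h d k hk
  refine le_iSup₂_of_le m ⟨l, hl⟩ ?_
  exact_mod_cast hdm

theorem zariskiClosure_subset {n : ℕ} {A V : Set (Fin n → ℂ)} (hV : IsAlgebraicVariety V)
    (hA : A ⊆ V) : zariskiClosure A ⊆ V := by
  obtain ⟨S, rfl⟩ := hV
  exact fun z hz p hp => hz p fun w hw => hA hw p hp

open Topology Filter in
theorem corollary1 (n : ℕ) (V : Set (Fin n → ℂ)) (hV : IsAlgebraicVariety V) :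
    (IsZariskiDenseIn (V ∩ unitTorus n) V → realDim (V ∩ unitTorus n) = complexDim V) ∧
      realDim (V ∩ unitTorus n) ≤ complexDim V := by
  have hsub : V ∩ unitTorus n ⊆ unitTorus n := Set.inter_subset_right
  have hcl := zariskiClosure_subset hV (Set.inter_subset_left (t := unitTorus n))
  have hle : realDim (V ∩ unitTorus n) ≤ complexDim V := by
    refine projectionDim_le_projectionDim fun d κ hκ => ?_
    obtain ⟨m, l, x₀, hdm, -, hev, -⟩ := exists_free_coordinates hsub
      ⟨_, injective_of_projectionContainsOpen hsub hκ⟩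
      (eq_zero_of_projectionContainsOpen_toRealCoords hsub hκ)
    obtain ⟨U, hU, hUo, hxU⟩ := eventually_nhds_iff.1 hev
    refine ⟨m, l, hdm, U, hUo, ⟨x₀, hxU⟩, fun x hx => ?_⟩
    obtain ⟨z, hz, hzx⟩ := hU x hx
    exact ⟨z, hcl hz, hzx⟩
  refine ⟨fun hdense => le_antisymm hle ?_, hle⟩
  refine projectionDim_le_projectionDim fun d k hk => ?_
  -- Density extends the vanishing of `p` from the toric points to all of `V`, whose projection
  -- contains an open set.
  obtain ⟨m, l, x₀, hdm, hx₀, -, hev⟩ := exists_free_coordinates hsub k fun p hp =>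
    eq_zero_of_projectionContainsOpen hk p fun z hz => by
      rw [← MvPolynomial.eval_rename]
      exact hdense.2 _ (fun w hw => by rw [MvPolynomial.eval_rename]; exact hp w hw) z hz
  obtain ⟨κ, hκ⟩ := exists_projectionContainsOpen_toRealCoords (A := V ∩ unitTorus n) l hx₀ (by
    filter_upwards [hev] with x hx hxT
    obtain ⟨z, hz, hzx⟩ := hx hxT
    exact ⟨z, ⟨hcl hz.1, hz.2⟩, hzx⟩)
  exact ⟨m, κ, hdm, hκ⟩
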